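/- Let $V$ be a finite nonempty set. A multigraph on $V$ is an undirected multigraph with vertex set $V$ (vertices labelled, no self-loops, multiple edges allowed), determined by the numbers $b_{vw}=b_{wv}\ge 0$ of edges joining distinct vertices $v,w$. Its Laplacian matrix is $Q(G)=D(G)-A(G)$, where $A(G)=(b_{vw})$ is the adjacency matrix (with zero diagonal) and $D(G)$ is the diagonal matrix of the vertex degrees $\sum_{w\neq v}b_{vw}$; its Laplacian lattice $L_G\subset\mathbb{Z}^V$ is the subgroup generated by the rows of $Q(G)$. For a subgroup $L\subset\mathbb{Z}^V$ let $N_{Gr}(L)$ be the number of connected multigraphs on $V$ whose Laplacian lattice is $L$. If $G$ is a multigraph on $V$ such that every pair of distinct vertices is joined by at least one edge, then $N_{Gr}(L_G)=1$; that is, $G$ is the only connected multigraph on $V$ whose Laplacian lattice is $L_G$. -/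

import Mathlib

/-- A (labelled, undirected) multigraph without self-loops on the vertex set `V`,
given by the number `mult v w` of edges joining `v` and `w`. -/
@[ext]
structure Multigraph (V : Type*) where
  /-- the number of edges joining two vertices -/
  mult : V → V → ℕ
  symm : ∀ v w, mult v w = mult w v
  loopless : ∀ v, mult v v = 0

namespace Multigraph

/-- The simple graph in which two vertices are adjacent iff at least one edge joins them. -/
def toSimple {V : Type*} (G : Multigraph V) : SimpleGraph V where
  Adj v w := 0 < G.mult v w
  symm := ⟨fun v w h => by rw [G.symm w v]; exact h⟩
  loopless := ⟨fun v h => by rw [G.loopless v] at h; exact lt_irrefl 0 h⟩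

/-- A multigraph is connected if any two vertices are joined by a path (and there is a vertex). -/
def Connected {V : Type*} (G : Multigraph V) : Prop :=
  G.toSimple.Connected

/-- The degree of a vertex, edges being counted with multiplicity. -/
def degree {V : Type*} [Fintype V] (G : Multigraph V) (v : V) : ℕ :=
  ∑ w, G.mult v w

/-- The vertex-adjacency matrix `A(G)`. -/
def adjMatrix {V : Type*} (G : Multigraph V) : Matrix V V ℤ :=
  Matrix.of fun v w => (G.mult v w : ℤ)

/-- The Laplacian matrix `Q(G) = D(G) - A(G)`. -/
def laplacian {V : Type*} [Fintype V] [DecidableEq V] (G : Multigraph V) : Matrix V V ℤ :=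
  Matrix.diagonal (fun v => (G.degree v : ℤ)) - G.adjMatrix

/-- The Laplacian lattice `L_G`: the subgroup of `ℤ^V` generated by the rows of `Q(G)`. -/
def laplacianLattice {V : Type*} [Fintype V] [DecidableEq V] (G : Multigraph V) :
    AddSubgroup (V → ℤ) :=
  AddSubgroup.closure (Set.range G.laplacian.row)

/-- `N_Gr(L)`: the number of (labelled) connected multigraphs on the vertex set `V` whose
Laplacian lattice is `L`, as an extended natural number. -/
noncomputable def numGraphs {V : Type*} [Fintype V] [DecidableEq V] (L : AddSubgroup (V → ℤ)) :
    ℕ∞ :=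
  {G : Multigraph V | G.Connected ∧ G.laplacianLattice = L}.encard

end Multigraph

namespace Multigraph

variable {V : Type*}

/-! Maximum principle plus integrality. If `L_H = L_G`, row `v` of `Q(G)` is `Q(H) y` and row `v` of
`Q(H)` is `Q(G) x`. The sign patterns of the rows make `y` and `x` strictly maximal at `v`; for `x`
this uses that all pairs are adjacent in `G`. An integer drop is at least 1, so `y` gives `deg_H v ≤
deg_G v` and `x` the reverse. Equality forces `x` to drop by exactly 1 everywhere, so `x` is `e_v`
plus a constant and the rows agree. -/

theorem connected_of_forall_mult_pos [Nonempty V] (G : Multigraph V)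
    (hG : ∀ v w : V, v ≠ w → 0 < G.mult v w) : G.Connected := by
  refine SimpleGraph.Connected.mk fun v w => ?_
  by_cases h : v = w
  · exact h ▸ SimpleGraph.Reachable.refl v
  · exact SimpleGraph.Adj.reachable (hG v w h)

variable [Fintype V]

/-- The Laplacian operator applied to an integer-valued function on the vertices. -/
def laplace (G : Multigraph V) (x : V → ℤ) (w : V) : ℤ :=
  ∑ u, (G.mult w u : ℤ) * (x w - x u)

theorem laplace_nonneg_of_isMax (G : Multigraph V) {x : V → ℤ} {w : V} (h : ∀ u, x u ≤ x w) :
    0 ≤ G.laplace x w :=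
  Finset.sum_nonneg fun u _ => mul_nonneg (Int.natCast_nonneg _) (sub_nonneg.2 (h u))

/-- If the Laplacian of `x` is nonpositive at a maximum `w` of `x`, then `x` takes its maximal value
at every neighbour of `w`. -/
theorem eq_of_laplace_nonpos_of_isMax (G : Multigraph V) {x : V → ℤ} {w : V}
    (h : ∀ u, x u ≤ x w) (h0 : G.laplace x w ≤ 0) {u : V} (hu : 0 < G.mult w u) : x u = x w := by
  have hz : ∑ u, (G.mult w u : ℤ) * (x w - x u) = 0 :=
    le_antisymm h0 (G.laplace_nonneg_of_isMax h)
  rw [Finset.sum_eq_zero_iff_of_nonneg fun u _ =>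
    mul_nonneg (Int.natCast_nonneg _) (sub_nonneg.2 (h u))] at hz
  rcases mul_eq_zero.1 (hz u (Finset.mem_univ u)) with h | h <;> omega

/-- By integrality each edge at `v` contributes at least 1. -/
theorem degree_le_laplace (G : Multigraph V) {x : V → ℤ} {v : V}
    (h : ∀ u, u ≠ v → x u < x v) : (G.degree v : ℤ) ≤ G.laplace x v := by
  rw [degree, laplace, Nat.cast_sum]
  refine Finset.sum_le_sum fun u _ => ?_
  by_cases huv : u = v
  · simp [huv, G.loopless]
  · exact le_mul_of_one_le_right (Int.natCast_nonneg _) (by have := h u huv; omega)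

/-- If all edges at `v` are present and `x` has a strict maximum at `v` at which its Laplacian
is at most the degree, then `x` drops by exactly one away from `v`. -/
theorem eq_add_one_of_laplace_le_degree (G : Multigraph V) {x : V → ℤ} {v : V}
    (hv : ∀ w, v ≠ w → 0 < G.mult v w) (h : ∀ u, u ≠ v → x u < x v)
    (hd : G.laplace x v ≤ G.degree v) {u : V} (hu : u ≠ v) : x v = x u + 1 := by
  have hterm : ∀ u ∈ Finset.univ, (G.mult v u : ℤ) ≤ (G.mult v u : ℤ) * (x v - x u) := by
    intro u _
    by_cases huv : u = v
    · simp [huv, G.loopless]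
    · exact le_mul_of_one_le_right (Int.natCast_nonneg _) (by have := h u huv; omega)
  have hsum : ∑ u, (G.mult v u : ℤ) = ∑ u, (G.mult v u : ℤ) * (x v - x u) := by
    refine le_antisymm (Finset.sum_le_sum hterm) ?_
    simpa [degree, laplace] using hd
  have hmul := (Finset.sum_eq_sum_iff_of_le hterm).1 hsum u (Finset.mem_univ u)
  have hpos : (G.mult v u : ℤ) ≠ 0 := by have := hv u hu.symm; omega
  have := (mul_eq_left₀ hpos).1 hmul.symm
  omega

variable [DecidableEq V]

theorem laplacian_self (G : Multigraph V) (v : V) : G.laplacian v v = G.degree v := by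
  simp [laplacian, adjMatrix, G.loopless]

theorem laplacian_of_ne (G : Multigraph V) {v w : V} (h : v ≠ w) :
    G.laplacian v w = -(G.mult v w : ℤ) := by
  simp [laplacian, adjMatrix, h]

theorem laplace_single (G : Multigraph V) (v : V) :
    G.laplace (Pi.single v 1) = G.laplacian v := by
  funext w
  by_cases h : v = w
  · subst h
    rw [laplacian_self, laplace, degree, Nat.cast_sum]
    refine Finset.sum_congr rfl fun u _ => ?_
    by_cases huv : u = v
    · simp [huv, G.loopless]
    · simp [huv]
  · rw [G.laplacian_of_ne h, laplace, Finset.sum_eq_single v]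
    · simp [Ne.symm h, G.symm w v]
    · intro u _ hu
      simp [hu, Ne.symm h]
    · simp

/-- Rows are images of the `Pi.single v 1`, and the operator is additive. -/
theorem exists_laplace_eq_of_mem_laplacianLattice (G : Multigraph V) {z : V → ℤ}
    (hz : z ∈ G.laplacianLattice) : ∃ x, G.laplace x = z := by
  induction hz using AddSubgroup.closure_induction with
  | mem z hz =>
    obtain ⟨v, rfl⟩ := hz
    exact ⟨_, G.laplace_single v⟩
  | zero => exact ⟨0, by funext w; simp [laplace]⟩
  | add a b _ _ ha hb =>
    obtain ⟨x, rfl⟩ := ha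
    obtain ⟨y, rfl⟩ := hb
    refine ⟨x + y, ?_⟩
    funext w
    simp only [laplace, Pi.add_apply, ← Finset.sum_add_distrib]
    exact Finset.sum_congr rfl fun u _ => by ring
  | neg a _ ha =>
    obtain ⟨x, rfl⟩ := ha
    refine ⟨-x, ?_⟩
    funext w
    simp only [laplace, Pi.neg_apply, ← Finset.sum_neg_distrib]
    exact Finset.sum_congr rfl fun u _ => by ring

theorem laplacian_mem_laplacianLattice (G : Multigraph V) (v : V) :
    G.laplacian v ∈ G.laplacianLattice :=
  AddSubgroup.subset_closure ⟨v, rfl⟩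

/-- A function whose Laplacian is negative away from `v` has a strict maximum at `v`. -/
theorem lt_of_laplace_neg (G : Multigraph V) {x : V → ℤ} {v : V}
    (h : ∀ w, w ≠ v → G.laplace x w < 0) {u : V} (hu : u ≠ v) : x u < x v := by
  have : Nonempty V := ⟨v⟩
  obtain ⟨m, hm⟩ := Finite.exists_max x
  have hmax : ∀ w, (∀ u, x u ≤ x w) → w = v := fun w hw => by
    by_contra hwv
    exact (h w hwv).not_ge (G.laplace_nonneg_of_isMax hw)
  obtain rfl := hmax m hm
  refine (hm u).lt_of_ne fun he => hu (hmax u fun w => he ▸ hm w)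

/-- If every two vertices are adjacent, a function whose Laplacian is nonpositive away from `v`
and does not vanish at `v` has a strict maximum at `v`. -/
theorem lt_of_laplace_nonpos (G : Multigraph V) (hG : ∀ v w : V, v ≠ w → 0 < G.mult v w)
    {x : V → ℤ} {v : V} (h : ∀ w, w ≠ v → G.laplace x w ≤ 0) (h0 : G.laplace x v ≠ 0)
    {u : V} (hu : u ≠ v) : x u < x v := by
  have : Nonempty V := ⟨v⟩
  obtain ⟨m, hm⟩ := Finite.exists_max x
  have hmax : ∀ w, (∀ u, x u ≤ x w) → w = v := fun w hw => by
    by_contra hwv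
    -- A maximum away from `v` spreads to every vertex in one step, so the Laplacian of `x` vanishes
    -- at `v`.
    have hconst : ∀ t, x t = x w := fun t => by
      by_cases htw : w = t
      · rw [htw]
      · exact G.eq_of_laplace_nonpos_of_isMax hw (h w hwv) (hG w t htw)
    exact h0 (by simp [laplace, hconst])
  obtain rfl := hmax m hm
  refine (hm u).lt_of_ne fun he => hu (hmax u fun w => he ▸ hm w)

/-- A multigraph in which every two vertices are adjacent is determined by its Laplacian lattice. -/
theorem eq_of_laplacianLattice_eq (G H : Multigraph V)
    (hG : ∀ v w : V, v ≠ w → 0 < G.mult v w) (hL : H.laplacianLattice = G.laplacianLattice) :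
    H = G := by
  have key : ∀ v w, v ≠ w → H.mult v w = G.mult v w := by
    intro v w hvw
    obtain ⟨y, hy⟩ := H.exists_laplace_eq_of_mem_laplacianLattice
      (hL ▸ G.laplacian_mem_laplacianLattice v)
    obtain ⟨x, hx⟩ := G.exists_laplace_eq_of_mem_laplacianLattice
      (hL ▸ H.laplacian_mem_laplacianLattice v)
    have hyv : H.laplace y v = G.degree v := by rw [hy, laplacian_self]
    have hxv : G.laplace x v = H.degree v := by rw [hx, laplacian_self]
    have hHG : H.degree v ≤ G.degree v := by
      have := H.degree_le_laplace (x := y) (v := v) fun u hu => H.lt_of_laplace_neg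
        (fun t ht => by
          rw [hy, G.laplacian_of_ne ht.symm]
          have := hG v t ht.symm
          omega) hu
      rw [hyv] at this
      exact_mod_cast this
    have hdG : 0 < G.degree v :=
      (hG v w hvw).trans_le (Finset.single_le_sum (f := G.mult v) (fun _ _ => Nat.zero_le _)
        (Finset.mem_univ w))
    -- If `v` were isolated in `H`, `H.laplace y` would vanish at `v`, where it equals `G.degree v >
    -- 0`.
    have hdH : G.laplace x v ≠ 0 := by
      rw [hxv]
      intro hzero
      have hmult : ∀ u, H.mult v u = 0 := by
        have : ∑ u, H.mult v u = 0 := by exact_mod_cast hzero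
        simpa using this
      have : H.laplace y v = 0 := by simp [laplace, hmult]
      rw [hyv] at this
      omega
    have hlt : ∀ u, u ≠ v → x u < x v := fun u hu =>
      G.lt_of_laplace_nonpos hG (fun t ht => by
        rw [hx, H.laplacian_of_ne ht.symm]
        omega) hdH hu
    have hone : ∀ u, u ≠ v → x v = x u + 1 := fun u hu =>
      G.eq_add_one_of_laplace_le_degree (hG v) hlt (by rw [hxv]; exact_mod_cast hHG) hu
    have hxs : G.laplace x = G.laplace (Pi.single v 1) := by
      -- The constant `x v - 1` is invisible to the Laplacian.
      have hform : ∀ u, x u = (Pi.single v 1 : V → ℤ) u + (x v - 1) := fun u => by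
        by_cases huv : u = v
        · simp [huv]
        · have := hone u huv
          simp [huv]
          omega
      funext t
      simp only [laplace]
      refine Finset.sum_congr rfl fun u _ => ?_
      rw [hform t, hform u]
      ring
    have := congrFun (hx.symm.trans (hxs.trans (G.laplace_single v))) w
    rw [H.laplacian_of_ne hvw, G.laplacian_of_ne hvw] at this
    omega
  ext v w
  by_cases hvw : v = w
  · rw [hvw, H.loopless, G.loopless]
  · exact key v w hvw

end Multigraph

theorem mainTheorem12 {V : Type*} [Fintype V] [DecidableEq V] [Nonempty V] (G : Multigraph V)
    (hG : ∀ v w : V, v ≠ w → 0 < G.mult v w) :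
    Multigraph.numGraphs G.laplacianLattice = 1 := by
  rw [Multigraph.numGraphs, Set.encard_eq_one]
  refine ⟨G, Set.eq_singleton_iff_unique_mem.2
    ⟨⟨G.connected_of_forall_mult_pos hG, rfl⟩, fun H hH => ?_⟩⟩
  exact G.eq_of_laplacianLattice_eq H hG hH.2
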